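/- For a finite connected graph \(G\) and a spanning tree \(T\) of \(G\), let \(A_e, B_e\) be, for each edge \(e\) of \(T\), the vertex sets of the two components of \(T-e\), and let \(e_G(A_e,B_e)\) be the number of edges of \(G\) with one end in \(A_e\) and the other in \(B_e\). Put \(\mathrm{ec}(G:T)=\max_{e\in E(T)} e_G(A_e,B_e)\) (understood as \(0\) if \(T\) has no edges), and let the spanning tree congestion of \(G\) be \(s(G)=\min\{\mathrm{ec}(G:T) : T \text{ is a spanning tree of } G\}\). For \(k\ge 2\), let \(T_k\) be the triangular grid obtained by dividing each side of a triangle into \(k-1\) equal pieces and joining the corresponding subdivision points of different sides by segments parallel to the sides of the triangle; the vertices of \(T_k\) are all the points of intersection of the segments (including the sides), and its edges are the pieces into which these points cut the segments. Let \(T_1\) be the graph with a single vertex. Then \[ s(T_{3n})=4n \quad (n\ge 1),\qquad s(T_{3n+1})=4n \quad (n\ge 0),\qquad s(T_{3n+2})=4n+2 \quad (n\ge 0). \] -/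

import Mathlib

/-- `T` is a spanning tree of `G`: a subgraph on the same vertex set which is a tree. -/
def IsSpanningTree {V : Type*} (G T : SimpleGraph V) : Prop :=
  T ≤ G ∧ T.IsTree

/-- The edges of `G` with one end vertex in `A` and the other end vertex in `B`. -/
def edgesBetween {V : Type*} (G : SimpleGraph V) (A B : Set V) : Set (Sym2 V) :=
  {f | f ∈ G.edgeSet ∧ ∃ a ∈ A, ∃ b ∈ B, f = s(a, b)}

/-- The vertex set of the component of `T - uv` that contains `u`. The vertex sets of the two
components of `T - e`, for an edge `e = uv` of a tree `T`, are `side T u v` and `side T v u`. -/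
def side {V : Type*} (T : SimpleGraph V) (u v : V) : Set V :=
  ((T.deleteEdges {s(u, v)}).connectedComponentMk u).supp

/-- The congestion in the edge `uv` of `T`: the number of edges of `G` which join
the two components of `T - uv`. -/
noncomputable def congestion {V : Type*} (G T : SimpleGraph V) (u v : V) : ℕ :=
  (edgesBetween G (side T u v) (side T v u)).ncard

open Classical in
/-- The edge congestion of `G` in `T`: the maximum, over the edges `uv` of `T`, of the congestion
in `uv` (it is `0` if `T` has no edges). -/
noncomputable def edgeCongestion {V : Type*} [Fintype V] (G T : SimpleGraph V) : ℕ :=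
  (Finset.univ.filter fun p : V × V => T.Adj p.1 p.2).sup fun p => congestion G T p.1 p.2

/-- `c` is the spanning tree congestion of `G`: the minimum of the edge congestions of `G` in its
spanning trees exists and equals `c`. -/
def IsSpanningTreeCongestion {V : Type*} [Fintype V] (G : SimpleGraph V) (c : ℕ) : Prop :=
  IsLeast {d : ℕ | ∃ T : SimpleGraph V, IsSpanningTree G T ∧ edgeCongestion G T = d} c

/-- The vertices of the triangular grid with `k` points on each side (each side being cut into
`k - 1` equal pieces). If the triangle has vertices `O`, `O + (k - 1) • x`, `O + (k - 1) • y`,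
then the pair `(i, j)` with `i + j ≤ k - 1` stands for the point `O + i • x + j • y`. -/
abbrev TriVertex (k : ℕ) : Type :=
  {p : Fin k × Fin k // (p.1 : ℕ) + (p.2 : ℕ) < k}

/-- `q` is the next vertex after `p` on a segment parallel to one of the three sides:
`q - p` is `x`, `y` or `x - y`. -/
def TriStep {k : ℕ} (p q : TriVertex k) : Prop :=
  ((q.1.1 : ℕ) = p.1.1 + 1 ∧ (q.1.2 : ℕ) = p.1.2) ∨
  ((q.1.1 : ℕ) = p.1.1 ∧ (q.1.2 : ℕ) = p.1.2 + 1) ∨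
  ((q.1.1 : ℕ) = p.1.1 + 1 ∧ (q.1.2 : ℕ) + 1 = p.1.2)

/-- The triangular grid `T_k`: vertices are joined when they are consecutive on one of the
segments parallel to the sides of the triangle. -/
def triangularGrid (k : ℕ) : SimpleGraph (TriVertex k) where
  Adj p q := TriStep p q ∨ TriStep q p
  symm := ⟨fun _ _ h => h.symm⟩
  loopless := ⟨fun p h => by
    unfold TriStep at h
    omega⟩

/-!
The three formulas say that the spanning tree congestion of the grid with `N + 1` points on each
side is `2 * ⌈2 N / 3⌉`. Vertices are described by barycentric coordinates `(x, y, z)` with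
`x + y + z = N`, where `z = N - x - y`.

The upward triangles partition the edges of the grid, and a set `A` of vertices cuts `0` or `2`
sides of each of them. So the edge boundary of `A` has even size, namely twice the number of cut
triangles (`ncard_edgesBetween_compl_eq_two_mul`). Counted along the lines of the grid, it is the
number of changes between `A` and its complement on all lines (`ncard_edgesBetween_compl_eq_lineVar`).

*Lower bound.* Let `v` be the median of the three corners in a spanning tree (`exists_median`), and
let `X`, `Y`, `Z` be the branches at `v` that contain the corners. It suffices that their edge
boundaries have at least `4 N` edges in total (`four_mul_le_sum_ncard`): the boundaries have even
sizes `2 p`, `2 q`, `2 r`, so that one of `p`, `q`, `r` is at least `⌈2 N / 3⌉`. Let `v = (x, y, z)`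
and colour the vertices of `X`, `Y`, `Z` by the unit vectors of `ℤ³`, all others by `0`. A line
on which the first coordinate is `a < x` separates `v` from the corners of `Y` and `Z`; hence it
meets both `Y` and `Z`, and the variation of the colouring along it is at least `2`. These lines and
their analogues for the two other coordinates give `2 (x + y + z) = 2 N`. A line with `a > x` meets
`X`, and the line with `a = x` contains `v`; so the variation along such a line is at least the sum
of the `ℓ¹` distances of the colours of its two ends from the colour of `X`, or from `0`
(`le_lineVar_add`). Through each of the `z + 1` points `(a, b, 0)` with `a ≥ x`, `b ≥ y` pass two
lines of this kind, and by the triangle inequality they contribute at that end at least the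
distance between two unit vectors, or between a unit vector and `0`; this gives `2 z` in total
(`two_mul_le_sum_colourDist`). The three sides of the grid yield another `2 (x + y + z) = 2 N`.

*Upper bound.* The tree of `parentCoord` has a row of the grid, about a third of the way up, as its
core; straight lines hang below the row, and a spine with half rows as teeth stands on its middle
vertex. All sets of descendants are simple regions whose cut triangles are counted directly
(`ncard_cutTriangles_isDescendant_le`).
-/


/-! ### Spanning trees given by parent functions -/

theorem mem_side {V : Type*} {T : SimpleGraph V} {u v w : V} :
    w ∈ side T u v ↔ (T.deleteEdges {s(u, v)}).Reachable w u := by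
  unfold side
  rw [SimpleGraph.ConnectedComponent.mem_supp_iff, SimpleGraph.ConnectedComponent.eq]

theorem SimpleGraph.Reachable.mem_iff_of_adj {V : Type*} {H : SimpleGraph V} {D : Set V}
    (hD : ∀ p q, H.Adj p q → (p ∈ D ↔ q ∈ D)) {u w : V} (h : H.Reachable u w) :
    u ∈ D ↔ w ∈ D := by
  obtain ⟨p⟩ := h
  induction p with
  | nil => rfl
  | cons hadj _ ih => exact (hD _ _ hadj).trans ih

theorem edgesBetween_comm {V : Type*} (G : SimpleGraph V) (A B : Set V) :
    edgesBetween G A B = edgesBetween G B A := by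
  ext f
  constructor <;> rintro ⟨hf, a, ha, b, hb, rfl⟩ <;> exact ⟨hf, b, hb, a, ha, Sym2.eq_swap⟩

theorem edgesBetween_mono {V : Type*} (G : SimpleGraph V) {A A' B B' : Set V} (hA : A ⊆ A')
    (hB : B ⊆ B') : edgesBetween G A B ⊆ edgesBetween G A' B' := by
  rintro f ⟨hf, a, ha, b, hb, rfl⟩
  exact ⟨hf, a, hA ha, b, hB hb, rfl⟩

/-- The graph joining each vertex `w` other than the root `ρ` to its parent. -/
def parentGraph {V : Type*} (ρ : V) (par : V → V) : SimpleGraph V where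
  Adj p q := p ≠ q ∧ ((p ≠ ρ ∧ q = par p) ∨ (q ≠ ρ ∧ p = par q))
  symm := ⟨fun _ _ h => ⟨h.1.symm, h.2.symm⟩⟩
  loopless := ⟨fun _ h => h.1 rfl⟩

/-- A parent function whose iteration leads to the root defines a spanning tree. The set `D w` plays
the role of the set of descendants of `w`: it is separated from its complement by the single tree
edge from `w` to its parent, so that its edge boundary bounds the congestion in this edge. -/
theorem exists_spanningTree_of_parent {V : Type*} [Fintype V] {G : SimpleGraph V} (ρ : V)
    (par : V → V) (rank : V → ℕ) (hpar : ∀ w, w ≠ ρ → G.Adj w (par w))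
    (hrank : ∀ w, w ≠ ρ → rank (par w) < rank w) (D : V → Set V)
    (hmem : ∀ w, w ≠ ρ → w ∈ D w) (hnot : ∀ w, w ≠ ρ → par w ∉ D w)
    (hclosed : ∀ w, w ≠ ρ → ∀ u, u ≠ ρ → u ≠ w → (u ∈ D w ↔ par u ∈ D w)) (M : ℕ)
    (hM : ∀ w, w ≠ ρ → (edgesBetween G (D w) (D w)ᶜ).ncard ≤ M) :
    ∃ T, IsSpanningTree G T ∧ edgeCongestion G T ≤ M := by
  have hadj : ∀ w, w ≠ ρ → (parentGraph ρ par).Adj w (par w) :=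
    fun w hw => ⟨(hpar w hw).ne, Or.inl ⟨hw, rfl⟩⟩
  have hroot : ∀ m w, rank w ≤ m → (parentGraph ρ par).Reachable w ρ := by
    intro m
    induction m with
    | zero =>
      intro w hw
      by_cases h : w = ρ
      · rw [h]
      · have := hrank w h
        omega
    | succ m ih =>
      intro w hw
      by_cases h : w = ρ
      · rw [h]
      · have := hrank w h
        exact (hadj w h).reachable.trans (ih (par w) (by omega))
  have hcl : ∀ w, w ≠ ρ → ∀ p q, ((parentGraph ρ par).deleteEdges {s(w, par w)}).Adj p q →
      (p ∈ D w ↔ q ∈ D w) := by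
    intro w hw p q hpq
    rw [SimpleGraph.deleteEdges_adj] at hpq
    obtain ⟨⟨-, h | h⟩, hne⟩ := hpq
    · obtain ⟨hp, rfl⟩ := h
      exact hclosed w hw p hp fun h => hne (by rw [h]; rfl)
    · obtain ⟨hq, rfl⟩ := h
      exact (hclosed w hw q hq fun h => hne (by rw [h]; exact Sym2.eq_swap)).symm
  have hsep : ∀ w, w ≠ ρ → side (parentGraph ρ par) w (par w) ⊆ D w ∧
      side (parentGraph ρ par) (par w) w ⊆ (D w)ᶜ := by
    intro w hw
    constructor
    · intro u hu
      exact (SimpleGraph.Reachable.mem_iff_of_adj (hcl w hw) (mem_side.1 hu)).2 (hmem w hw)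
    · intro u hu
      rw [mem_side, Sym2.eq_swap] at hu
      exact fun h => hnot w hw ((SimpleGraph.Reachable.mem_iff_of_adj (hcl w hw) hu).1 h)
  have hcong : ∀ w, w ≠ ρ → congestion G (parentGraph ρ par) w (par w) ≤ M := fun w hw =>
    (Set.ncard_le_ncard (edgesBetween_mono G (hsep w hw).1 (hsep w hw).2)
      (Set.toFinite _)).trans (hM w hw)
  have hcong' : ∀ w, w ≠ ρ → congestion G (parentGraph ρ par) (par w) w ≤ M := fun w hw => by
    rw [congestion, edgesBetween_comm]
    exact hcong w hw
  refine ⟨parentGraph ρ par, ⟨?_, ?_, ?_⟩, ?_⟩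
  · rintro p q ⟨-, ⟨hp, rfl⟩ | ⟨hq, rfl⟩⟩
    · exact hpar p hp
    · exact (hpar q hq).symm
  · have : Nonempty V := ⟨ρ⟩
    exact ⟨fun p q => (hroot _ p le_rfl).trans (hroot _ q le_rfl).symm⟩
  · rw [SimpleGraph.isAcyclic_iff_forall_adj_isBridge]
    have key : ∀ w, w ≠ ρ → (parentGraph ρ par).IsBridge s(w, par w) := fun w hw => by
      rw [SimpleGraph.isBridge_iff]
      refine fun h => hnot w hw ?_
      exact (SimpleGraph.Reachable.mem_iff_of_adj (hcl w hw) h).1 (hmem w hw)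
    rintro p q ⟨-, ⟨hp, rfl⟩ | ⟨hq, rfl⟩⟩
    · exact key p hp
    · rw [Sym2.eq_swap]
      exact key q hq
  · refine Finset.sup_le fun p hp => ?_
    simp only [Finset.mem_filter] at hp
    obtain ⟨-, -, ⟨h, h'⟩ | ⟨h, h'⟩⟩ := hp
    · rw [h']
      exact hcong _ h
    · rw [h']
      exact hcong' _ h

/-! ### Medians of three vertices in a spanning tree -/

theorem congestion_le_edgeCongestion {V : Type*} [Fintype V] {G T : SimpleGraph V} {u v : V}
    (h : T.Adj u v) : congestion G T u v ≤ edgeCongestion G T := by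
  unfold edgeCongestion
  refine Finset.le_sup (f := fun p : V × V => congestion G T p.1 p.2) (b := (u, v)) ?_
  simpa only [Finset.mem_filter, Finset.mem_univ, true_and] using h

theorem side_swap_eq_compl {V : Type*} {T : SimpleGraph V} (hT : T.IsTree) {u v : V}
    (h : T.Adj u v) : side T v u = (side T u v)ᶜ := by
  have hb : ¬ (T.deleteEdges {s(u, v)}).Reachable u v :=
    SimpleGraph.isBridge_iff.1 (SimpleGraph.isAcyclic_iff_forall_adj_isBridge.1 hT.2 h)
  ext w
  rw [Set.mem_compl_iff, mem_side, mem_side, Sym2.eq_swap]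
  constructor
  · exact fun h1 h2 => hb (h2.symm.trans h1)
  · intro h1
    by_contra h2
    -- the vertices that reach neither end of the deleted edge would be cut off from `u` in `T`
    have := (SimpleGraph.Reachable.mem_iff_of_adj (H := T)
      (D := {x | (T.deleteEdges {s(u, v)}).Reachable x u ∨
        (T.deleteEdges {s(u, v)}).Reachable x v}) ?_ (hT.1.preconnected u w)).1
      (Or.inl (SimpleGraph.Reachable.refl u))
    · exact this.elim h1 h2
    · intro p q hpq
      by_cases he : s(p, q) = s(u, v)
      · rcases Sym2.eq_iff.1 he with ⟨rfl, rfl⟩ | ⟨rfl, rfl⟩ <;>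
          simp
      · have hr : (T.deleteEdges {s(u, v)}).Reachable p q :=
          SimpleGraph.Adj.reachable (SimpleGraph.deleteEdges_adj.2 ⟨hpq, he⟩)
        exact or_congr ⟨hr.symm.trans, hr.trans⟩ ⟨hr.symm.trans, hr.trans⟩

theorem disjoint_side {V : Type*} {T : SimpleGraph V} (hT : T.IsTree) {u u' v : V}
    (h : T.Adj u v) (h' : T.Adj u' v) (hne : u ≠ u') : Disjoint (side T u v) (side T u' v) := by
  have hv : ∀ {u}, T.Adj u v → v ∉ side T u v := fun h => by
    rw [← Set.mem_compl_iff, ← side_swap_eq_compl hT h, mem_side]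
  have hv' := hv h'
  have hstep : ∀ p q, (T.deleteEdges {s(u, v)}).Adj p q → p ∈ side T u v →
      (T.deleteEdges {s(u', v)}).Adj p q := by
    intro p q hpq hp
    have hq : q ∈ side T u v := mem_side.2 (hpq.symm.reachable.trans (mem_side.1 hp))
    have hpv : p ≠ v := fun e => hv h (e ▸ hp)
    have hqv : q ≠ v := fun e => hv h (e ▸ hq)
    refine SimpleGraph.deleteEdges_adj.2 ⟨(SimpleGraph.deleteEdges_adj.1 hpq).1, fun e => ?_⟩
    rcases Sym2.eq_iff.1 e with ⟨_, e⟩ | ⟨e, _⟩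
    · exact hqv e
    · exact hpv e
  rw [Set.disjoint_left]
  intro w hw hw'
  have huu' : u ∈ side T u' v := by
    refine ((SimpleGraph.Reachable.mem_iff_of_adj (D := side T u v ∩ side T u' v) ?_
      (mem_side.1 hw)).1 ⟨hw, hw'⟩).2
    have key : ∀ p q, (T.deleteEdges {s(u, v)}).Adj p q → p ∈ side T u v ∩ side T u' v →
        q ∈ side T u v ∩ side T u' v := fun p q hpq hp =>
      ⟨mem_side.2 (hpq.symm.reachable.trans (mem_side.1 hp.1)),
        mem_side.2 ((hstep p q hpq hp.1).symm.reachable.trans (mem_side.1 hp.2))⟩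
    exact fun p q hpq => ⟨key p q hpq, key q p hpq.symm⟩
  refine hv' (mem_side.2 (SimpleGraph.Reachable.trans (SimpleGraph.Adj.reachable ?_)
    (mem_side.1 huu')))
  refine SimpleGraph.deleteEdges_adj.2 ⟨h.symm, fun e => ?_⟩
  rcases Sym2.eq_iff.1 e with ⟨e, _⟩ | ⟨_, e⟩
  · exact h'.ne e.symm
  · exact hne e

/-- A vertex of a tree other than `v` lies behind a neighbour of `v` that is closer to it. -/
theorem exists_adj_mem_side {V : Type*} {T : SimpleGraph V} (hT : T.IsTree) {v a : V}
    (hav : a ≠ v) : ∃ u, T.Adj u v ∧ T.dist u a < T.dist v a ∧ a ∈ side T u v := by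
  obtain ⟨p, hp⟩ := hT.1.exists_walk_length_eq_dist v a
  cases p with
  | nil => exact absurd rfl hav
  | @cons _ u _ hadj p =>
    rw [SimpleGraph.Walk.length_cons] at hp
    have hlt : T.dist u a < T.dist v a := by
      have := SimpleGraph.dist_le p
      omega
    refine ⟨u, hadj.symm, hlt, ?_⟩
    by_contra hcon
    rw [← Set.mem_compl_iff, ← side_swap_eq_compl hT hadj.symm, mem_side] at hcon
    classical
    -- a shortest walk from `u` to `a` would have to pass through `v`
    obtain ⟨q, hq⟩ := hT.1.exists_walk_length_eq_dist u a
    have hvq : v ∈ q.support := by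
      by_contra hvq
      have : a ∈ side T u v := by
        refine mem_side.2 (SimpleGraph.Reachable.symm ⟨q.toDeleteEdge s(u, v) fun he => ?_⟩)
        exact hvq (q.snd_mem_support_of_mem_edges he)
      rw [side_swap_eq_compl hT hadj] at this
      exact this (mem_side.2 hcon)
    have h1 := SimpleGraph.dist_le (q.dropUntil v hvq)
    have h2 := q.length_dropUntil_le_length hvq
    omega

/-- Three vertices of a spanning tree have a median `v`: those of them that differ from `v` lie in
different branches of the tree at `v`. If `a i = v`, the branch `S i` is taken to be empty. -/
theorem exists_median {V : Type*} [Fintype V] {G T : SimpleGraph V} (hT : IsSpanningTree G T)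
    (a : Fin 3 → V) : ∃ (v : V) (S : Fin 3 → Set V), (∀ i, v ∉ S i) ∧
      (∀ i j, i ≠ j → Disjoint (S i) (S j)) ∧
      (∀ i, ∃ p : G.Walk v (a i), ∀ w ∈ p.support, w = v ∨ w ∈ S i) ∧
      ∀ i, (edgesBetween G (S i) (S i)ᶜ).ncard ≤ edgeCongestion G T := by
  classical
  have : Nonempty V := ⟨a 0⟩
  obtain ⟨v, hv⟩ := Finite.exists_min fun v => T.dist v (a 0) + T.dist v (a 1) + T.dist v (a 2)
  have htri : ∀ {u} i, T.Adj u v → T.dist u (a i) ≤ 1 + T.dist v (a i) := fun {u} i h => by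
    have := hT.2.1.dist_triangle (u := u) (v := v) (w := a i)
    rwa [SimpleGraph.dist_eq_one_iff_adj.2 h] at this
  have hex : ∀ i, ∃ u, a i ≠ v → T.Adj u v ∧ T.dist u (a i) < T.dist v (a i) ∧
      a i ∈ side T u v := fun i => by
    by_cases h : a i = v
    · exact ⟨v, fun h' => absurd h h'⟩
    · obtain ⟨u, hu⟩ := exists_adj_mem_side hT.2 h
      exact ⟨u, fun _ => hu⟩
  choose u hu using hex
  have hne : ∀ i j, i ≠ j → a i ≠ v → a j ≠ v → u i ≠ u j := by
    intro i j hij hi hj e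
    have h1 := (hu i hi).2.1
    have h2 := (hu j hj).2.1
    rw [← e] at h2
    have h3 := hv (u i)
    have t0 := htri 0 (hu i hi).1
    have t1 := htri 1 (hu i hi).1
    have t2 := htri 2 (hu i hi).1
    fin_cases i <;> fin_cases j <;> simp at * <;> omega
  refine ⟨v, fun i => {w | a i ≠ v ∧ w ∈ side T (u i) v}, ?_, ?_, ?_, ?_⟩
  · rintro i ⟨hi, h⟩
    rw [side_swap_eq_compl hT.2 (hu i hi).1.symm] at h
    exact h (mem_side.2 (SimpleGraph.Reachable.refl v))
  · intro i j hij
    rw [Set.disjoint_left]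
    rintro w ⟨hi, hwi⟩ ⟨hj, hwj⟩
    exact Set.disjoint_left.1
      (disjoint_side hT.2 (hu i hi).1 (hu j hj).1 (hne i j hij hi hj)) hwi hwj
  · intro i
    by_cases hi : a i = v
    · exact ⟨SimpleGraph.Walk.nil.copy rfl hi.symm, fun w hw => Or.inl (by simpa using hw)⟩
    · obtain ⟨q⟩ := (mem_side.1 (hu i hi).2.2).symm
      have hle : T.deleteEdges {s(u i, v)} ≤ G := (T.deleteEdges_le _).trans hT.1
      refine ⟨SimpleGraph.Walk.cons (hT.1 (hu i hi).1.symm) (q.mapLe hle), fun w hw => ?_⟩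
      rw [SimpleGraph.Walk.support_cons, List.mem_cons] at hw
      refine hw.imp id fun hw => ⟨hi, mem_side.2 ?_⟩
      rw [SimpleGraph.Walk.support_mapLe_eq_support] at hw
      exact SimpleGraph.Reachable.symm ⟨q.takeUntil w hw⟩
  · intro i
    by_cases hi : a i = v
    · have : edgesBetween G {w | a i ≠ v ∧ w ∈ side T (u i) v}
          {w | a i ≠ v ∧ w ∈ side T (u i) v}ᶜ = ∅ := by
        ext f
        simp [edgesBetween, hi]
      rw [this]
      simp
    · have : {w | a i ≠ v ∧ w ∈ side T (u i) v} = side T (u i) v := by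
        ext w
        simp [hi]
      beta_reduce
      rw [this, ← side_swap_eq_compl hT.2 (hu i hi).1]
      exact congestion_le_edgeCongestion (hu i hi).1

/-! ### Upward triangles and the lines of the grid -/

/-- The vertex `(i, j)` of the grid with `N + 1` points on each side. -/
def gridVertex (N i j : ℕ) (h : i + j ≤ N) : TriVertex (N + 1) :=
  ⟨(⟨i, by omega⟩, ⟨j, by omega⟩), by simp only; omega⟩

theorem gridVertex_inj {N i j i' j' : ℕ} {h : i + j ≤ N} {h' : i' + j' ≤ N} :
    gridVertex N i j h = gridVertex N i' j' h' ↔ i = i' ∧ j = j' := by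
  simp [gridVertex, Subtype.ext_iff, Prod.ext_iff]

theorem exists_gridVertex {N : ℕ} (p : TriVertex (N + 1)) :
    ∃ i j, ∃ h : i + j ≤ N, p = gridVertex N i j h :=
  ⟨p.1.1, p.1.2, by have := p.2; omega, rfl⟩

/-- The corner `(i, j)` of the upward triangle with corners `(i, j)`, `(i + 1, j)`, `(i, j + 1)`.
The upward triangles of the grid with `N + 1` points on each side are indexed by the vertices
`(i, j)` of the grid with `N` points on each side. -/
def cornerO {N : ℕ} (t : TriVertex N) : TriVertex (N + 1) :=
  gridVertex N t.1.1 t.1.2 (by have := t.2; omega)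

/-- The corner `(i + 1, j)` of the upward triangle indexed by `(i, j)`. -/
def cornerX {N : ℕ} (t : TriVertex N) : TriVertex (N + 1) :=
  gridVertex N (t.1.1 + 1) t.1.2 (by have := t.2; omega)

/-- The corner `(i, j + 1)` of the upward triangle indexed by `(i, j)`. -/
def cornerY {N : ℕ} (t : TriVertex N) : TriVertex (N + 1) :=
  gridVertex N t.1.1 (t.1.2 + 1) (by have := t.2; omega)

/-- The three sides of an upward triangle; side number `0`, `1`, `2` lies on a line on which the
first, the second, the third barycentric coordinate is constant. -/
def triangleSide {N : ℕ} (t : TriVertex N) (d : Fin 3) : TriVertex (N + 1) × TriVertex (N + 1) :=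
  ![(cornerO t, cornerY t), (cornerX t, cornerO t), (cornerY t, cornerX t)] d

theorem triangleSide_adj {N : ℕ} (t : TriVertex N) (d : Fin 3) :
    (triangularGrid (N + 1)).Adj (triangleSide t d).1 (triangleSide t d).2 := by
  fin_cases d <;> simp [triangleSide, triangularGrid, TriStep, cornerO, cornerX, cornerY,
    gridVertex]

theorem triangleSide_injective {N : ℕ} : Function.Injective fun q : TriVertex N × Fin 3 =>
    s((triangleSide q.1 q.2).1, (triangleSide q.1 q.2).2) := by
  rintro ⟨t, d⟩ ⟨t', d'⟩ h
  have ht : t = t' ↔ (t.1.1 : ℕ) = t'.1.1 ∧ (t.1.2 : ℕ) = t'.1.2 := by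
    simp [Subtype.ext_iff, Prod.ext_iff, Fin.ext_iff]
  have h' := Sym2.eq_iff.1 h
  rw [Prod.mk.injEq, ht]
  fin_cases d <;> fin_cases d' <;>
    simp [triangleSide, cornerO, cornerX, cornerY, gridVertex_inj] at h' ⊢ <;> omega

/-- Every edge of the grid is a side of an upward triangle. -/
theorem exists_triangleSide_eq {N : ℕ} {p q : TriVertex (N + 1)}
    (h : (triangularGrid (N + 1)).Adj p q) : ∃ t : TriVertex N, ∃ d,
      s((triangleSide t d).1, (triangleSide t d).2) = s(p, q) := by
  have key : ∀ p q : TriVertex (N + 1), TriStep p q → ∃ t : TriVertex N, ∃ d,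
      s((triangleSide t d).1, (triangleSide t d).2) = s(p, q) := by
    intro p q h
    obtain ⟨i, j, hij, rfl⟩ := exists_gridVertex p
    obtain ⟨i', j', hij', rfl⟩ := exists_gridVertex q
    simp only [TriStep, gridVertex] at h
    rcases h with h | h | h
    · refine ⟨⟨(⟨i, by omega⟩, ⟨j, by omega⟩), by simp only; omega⟩, 1, ?_⟩
      simp [triangleSide, cornerO, cornerX, gridVertex_inj]
      omega
    · refine ⟨⟨(⟨i, by omega⟩, ⟨j, by omega⟩), by simp only; omega⟩, 0, ?_⟩
      simp [triangleSide, cornerO, cornerY, gridVertex_inj]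
      omega
    · refine ⟨⟨(⟨i, by omega⟩, ⟨j', by omega⟩), by simp only; omega⟩, 2, ?_⟩
      simp [triangleSide, cornerX, cornerY, gridVertex_inj]
      omega
  rcases h with h | h
  · exact key p q h
  · obtain ⟨t, d, e⟩ := key q p h
    exact ⟨t, d, e.trans Sym2.eq_swap⟩

open Classical in
theorem ncard_edgesBetween_compl {N : ℕ} (A : Set (TriVertex (N + 1))) :
    (edgesBetween (triangularGrid (N + 1)) A Aᶜ).ncard = ∑ t : TriVertex N, ∑ d : Fin 3,
      if (triangleSide t d).1 ∈ A ↔ (triangleSide t d).2 ∈ A then 0 else 1 := by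
  have himage : edgesBetween (triangularGrid (N + 1)) A Aᶜ =
      (fun q : TriVertex N × Fin 3 => s((triangleSide q.1 q.2).1, (triangleSide q.1 q.2).2)) ''
        {q | ¬((triangleSide q.1 q.2).1 ∈ A ↔ (triangleSide q.1 q.2).2 ∈ A)} := by
    ext f
    constructor
    · rintro ⟨hf, a, ha, b, hb, rfl⟩
      obtain ⟨t, d, e⟩ := exists_triangleSide_eq ((SimpleGraph.mem_edgeSet _).1 hf)
      refine ⟨(t, d), ?_, e⟩
      rw [Set.mem_compl_iff] at hb
      rcases Sym2.eq_iff.1 e with ⟨h1, h2⟩ | ⟨h1, h2⟩ <;> simp [h1, h2, ha, hb]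
    · rintro ⟨⟨t, d⟩, h, rfl⟩
      refine ⟨triangleSide_adj t d, ?_⟩
      rw [Set.mem_ofPred_eq] at h
      by_cases h1 : (triangleSide t d).1 ∈ A
      · exact ⟨_, h1, (triangleSide t d).2, fun h2 => h (by simp [h1, h2]), rfl⟩
      · refine ⟨(triangleSide t d).2, ?_, _, h1, Sym2.eq_swap⟩
        by_contra h2
        exact h (by simp [h1, h2])
  rw [himage, Set.ncard_image_of_injective _ triangleSide_injective, Set.ncard_eq_toFinset_card',
    ← Fintype.sum_prod_type' (f := fun (t : TriVertex N) (d : Fin 3) =>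
      if (triangleSide t d).1 ∈ A ↔ (triangleSide t d).2 ∈ A then 0 else 1),
    Set.toFinset_ofPred, Finset.card_filter]
  refine Finset.sum_congr rfl fun q _ => ?_
  by_cases h : (triangleSide q.1 q.2).1 ∈ A ↔ (triangleSide q.1 q.2).2 ∈ A <;> simp [h]

/-- The upward triangles which have corners both inside and outside of `A`. -/
def cutTriangles {N : ℕ} (A : Set (TriVertex (N + 1))) : Set (TriVertex N) :=
  {t | ¬((cornerO t ∈ A ↔ cornerX t ∈ A) ∧ (cornerO t ∈ A ↔ cornerY t ∈ A))}

/-- The upward triangles partition the edges of the grid, and a triangle cut by `A` has exactly two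
sides which leave `A`. -/
theorem ncard_edgesBetween_compl_eq_two_mul {N : ℕ} (A : Set (TriVertex (N + 1))) :
    (edgesBetween (triangularGrid (N + 1)) A Aᶜ).ncard = 2 * (cutTriangles A).ncard := by
  classical
  rw [ncard_edgesBetween_compl, Set.ncard_eq_toFinset_card', cutTriangles, Set.toFinset_ofPred,
    Finset.card_filter, Finset.mul_sum]
  refine Finset.sum_congr rfl fun t _ => ?_
  rw [Fin.sum_univ_three]
  by_cases h1 : cornerO t ∈ A <;> by_cases h2 : cornerX t ∈ A <;> by_cases h3 : cornerY t ∈ A <;>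
    simp [triangleSide, h1, h2, h3]

/-- The total variation of `f` along the lines of the grid on which the first barycentric
coordinate is constant. Functions on the grid are written in the three barycentric coordinates;
only their values at `(a, b, c)` with `a + b + c = N` matter. -/
def lineVar (N : ℕ) (f : ℕ → ℕ → ℕ → ℤ) : ℤ :=
  ∑ a ∈ Finset.range (N + 1), ∑ s ∈ Finset.range (N - a),
    |f a (s + 1) (N - 1 - a - s) - f a s (N - 1 - a - s + 1)|

/-- Rotation of the barycentric coordinates, which turns the second coordinate into the first. -/
def rotate (f : ℕ → ℕ → ℕ → ℤ) : ℕ → ℕ → ℕ → ℤ := fun a b c => f c a b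

open Classical in
/-- The indicator function of a set of vertices, in barycentric coordinates. -/
noncomputable def indicatorFn {N : ℕ} (A : Set (TriVertex (N + 1))) (x y z : ℕ) : ℤ :=
  if ∃ p ∈ A, (p.1.1 : ℕ) = x ∧ (p.1.2 : ℕ) = y ∧ x + y + z = N then 1 else 0

theorem sum_triVertex_eq (N : ℕ) (g : ℕ → ℕ → ℕ → ℤ) :
    (∑ t : TriVertex N, g t.1.1 t.1.2 (N - 1 - t.1.1 - t.1.2) =
      ∑ a ∈ Finset.range (N + 1), ∑ s ∈ Finset.range (N - a), g a s (N - 1 - a - s)) ∧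
    (∑ t : TriVertex N, g t.1.1 t.1.2 (N - 1 - t.1.1 - t.1.2) =
      ∑ a ∈ Finset.range (N + 1), ∑ s ∈ Finset.range (N - a), g (N - 1 - a - s) a s) ∧
    (∑ t : TriVertex N, g t.1.1 t.1.2 (N - 1 - t.1.1 - t.1.2) =
      ∑ a ∈ Finset.range (N + 1), ∑ s ∈ Finset.range (N - a), g s (N - 1 - a - s) a) := by
  have ht : ∀ t t' : TriVertex N, t = t' ↔ (t.1.1 : ℕ) = t'.1.1 ∧ (t.1.2 : ℕ) = t'.1.2 := by
    simp [Subtype.ext_iff, Prod.ext_iff, Fin.ext_iff]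
  refine ⟨?_, ?_, ?_⟩ <;> rw [Finset.sum_sigma']
  · refine Finset.sum_bij (fun t _ => ⟨t.1.1, t.1.2⟩) ?_ ?_ ?_ ?_
    · intro t _
      have := t.2
      simp only [Finset.mem_sigma, Finset.mem_range]
      omega
    · intro t _ t' _ h
      simp only [Sigma.mk.injEq, heq_eq_eq] at h
      rw [ht]
      omega
    · rintro ⟨a, s⟩ h
      simp only [Finset.mem_sigma, Finset.mem_range] at h
      refine ⟨⟨(⟨a, by omega⟩, ⟨s, by omega⟩), by simp only; omega⟩, Finset.mem_univ _, ?_⟩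
      simp
    · intro t _
      rfl
  · refine Finset.sum_bij (fun t _ => ⟨t.1.2, N - 1 - t.1.1 - t.1.2⟩) ?_ ?_ ?_ ?_
    · intro t _
      have := t.2
      simp only [Finset.mem_sigma, Finset.mem_range]
      omega
    · intro t _ t' _ h
      simp only [Sigma.mk.injEq, heq_eq_eq] at h
      have := t.2
      have := t'.2
      rw [ht]
      omega
    · rintro ⟨a, s⟩ h
      simp only [Finset.mem_sigma, Finset.mem_range] at h
      refine ⟨⟨(⟨N - 1 - a - s, by omega⟩, ⟨a, by omega⟩), by simp only; omega⟩,
        Finset.mem_univ _, Sigma.ext rfl (heq_of_eq ?_)⟩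
      change N - 1 - (N - 1 - a - s) - a = s
      omega
    · intro t _
      have := t.2
      dsimp only
      congr 1
      omega
  · refine Finset.sum_bij (fun t _ => ⟨N - 1 - t.1.1 - t.1.2, t.1.1⟩) ?_ ?_ ?_ ?_
    · intro t _
      have := t.2
      simp only [Finset.mem_sigma, Finset.mem_range]
      omega
    · intro t _ t' _ h
      simp only [Sigma.mk.injEq, heq_eq_eq] at h
      have := t.2
      have := t'.2
      rw [ht]
      omega
    · rintro ⟨a, s⟩ h
      simp only [Finset.mem_sigma, Finset.mem_range] at h
      refine ⟨⟨(⟨s, by omega⟩, ⟨N - 1 - a - s, by omega⟩), by simp only; omega⟩,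
        Finset.mem_univ _, Sigma.ext ?_ (heq_of_eq rfl)⟩
      change N - 1 - s - (N - 1 - a - s) = a
      omega
    · intro t _
      have := t.2
      dsimp only
      congr 1
      omega

theorem indicatorFn_gridVertex {N : ℕ} (A : Set (TriVertex (N + 1))) {x y z : ℕ}
    (h : x + y + z = N) : indicatorFn A x y z =
      @ite _ (gridVertex N x y (by omega) ∈ A) (Classical.propDecidable _) 1 0 := by
  classical
  unfold indicatorFn
  refine if_congr ⟨?_, fun hA => ⟨_, hA, rfl, rfl, h⟩⟩ rfl rfl
  rintro ⟨p, hp, rfl, rfl, -⟩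
  exact hp

/-- The size of the edge boundary, as the number of changes along all lines of the grid. -/
theorem ncard_edgesBetween_compl_eq_lineVar {N : ℕ} (A : Set (TriVertex (N + 1))) :
    ((edgesBetween (triangularGrid (N + 1)) A Aᶜ).ncard : ℤ) = lineVar N (indicatorFn A) +
      lineVar N (rotate (indicatorFn A)) + lineVar N (rotate (rotate (indicatorFn A))) := by
  classical
  rw [ncard_edgesBetween_compl, lineVar, lineVar, lineVar,
    ← (sum_triVertex_eq N fun x y z =>
      |indicatorFn A x (y + 1) z - indicatorFn A x y (z + 1)|).1]
  simp only [rotate]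
  rw [← (sum_triVertex_eq N fun x y z =>
      |indicatorFn A x y (z + 1) - indicatorFn A (x + 1) y z|).2.1,
    ← (sum_triVertex_eq N fun x y z =>
      |indicatorFn A (x + 1) y z - indicatorFn A x (y + 1) z|).2.2,
    ← Finset.sum_add_distrib, ← Finset.sum_add_distrib, Nat.cast_sum]
  refine Finset.sum_congr rfl fun t _ => ?_
  have := t.2
  rw [indicatorFn_gridVertex A (by omega), indicatorFn_gridVertex A (by omega),
    indicatorFn_gridVertex A (by omega), Fin.sum_univ_three]
  change ((((if cornerO t ∈ A ↔ cornerY t ∈ A then 0 else 1) +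
    (if cornerX t ∈ A ↔ cornerO t ∈ A then 0 else 1) +
    (if cornerY t ∈ A ↔ cornerX t ∈ A then 0 else 1) : ℕ)) : ℤ) =
    |(if cornerY t ∈ A then 1 else 0) - (if cornerO t ∈ A then 1 else 0)| +
    |(if cornerO t ∈ A then 1 else 0) - (if cornerX t ∈ A then 1 else 0)| +
    |(if cornerX t ∈ A then 1 else 0) - (if cornerY t ∈ A then 1 else 0)|
  by_cases h1 : cornerO t ∈ A <;> by_cases h2 : cornerX t ∈ A <;> by_cases h3 : cornerY t ∈ A <;>
    simp [h1, h2, h3]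

/-! ### The lower bound -/

theorem abs_add_abs_le_sum_abs (g : ℕ → ℤ) {m w : ℕ} (hw : w ≤ m) :
    |g w - g 0| + |g w - g m| ≤ ∑ s ∈ Finset.range m, |g (s + 1) - g s| := by
  have h0 : ∀ w, |g w - g 0| ≤ ∑ s ∈ Finset.range w, |g (s + 1) - g s| := fun w => by
    induction w with
    | zero => simp
    | succ w ih =>
      rw [Finset.sum_range_succ]
      have := abs_sub_le (g (w + 1)) (g w) (g 0)
      omega
  induction m, hw using Nat.le_induction with
  | base => simpa using h0 w
  | succ m _ ih =>
    rw [Finset.sum_range_succ]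
    have := abs_sub_le (g w) (g m) (g (m + 1))
    rw [abs_sub_comm (g m)] at this
    omega

theorem line_abs_le (N : ℕ) (f : ℕ → ℕ → ℕ → ℤ) {a w : ℕ} (ha : a ≤ N) (hw : w ≤ N - a) :
    |f a w (N - a - w) - f a 0 (N - a)| + |f a w (N - a - w) - f a (N - a) 0| ≤
      ∑ s ∈ Finset.range (N - a), |f a (s + 1) (N - 1 - a - s) - f a s (N - 1 - a - s + 1)| := by
  have h := abs_add_abs_le_sum_abs (fun s => f a s (N - a - s)) hw
  simp only [Nat.sub_zero, Nat.sub_self] at h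
  refine h.trans (Finset.sum_le_sum fun s hs => ?_)
  rw [Finset.mem_range] at hs
  rw [show N - a - (s + 1) = N - 1 - a - s by omega, show N - a - s = N - 1 - a - s + 1 by omega]

/-- The `ℓ¹` distance of `(p, q, r)` from the colour `(1, 0, 0)` of the first class if `0 < s`, and
from the colour `(0, 0, 0)` of an uncoloured vertex if `s = 0`. -/
def colourDist (s : ℕ) (p q r : ℤ) : ℤ :=
  |(if 0 < s then 1 else 0) - p| + |q| + |r|

theorem colourDist_nonneg (s : ℕ) (p q r : ℤ) : 0 ≤ colourDist s p q r := by
  unfold colourDist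
  positivity

/-- The variation of a colouring with three classes along the lines of the first direction. Here
`(x, y, z)` is an uncoloured vertex, the lines beyond it meet the class `X` of the first corner of
the grid, and the lines before it meet the classes `Y` and `Z` of the two other corners. -/
theorem le_lineVar_add (N : ℕ) (X Y Z : ℕ → ℕ → ℕ → ℤ) {x y z : ℕ} (hN : x + y + z = N)
    (hv : X x y z = 0 ∧ Y x y z = 0 ∧ Z x y z = 0)
    (hX : ∀ a, x < a → a ≤ N → ∃ b c, a + b + c = N ∧ X a b c = 1 ∧ Y a b c = 0 ∧ Z a b c = 0)
    (hY : ∀ a < x, ∃ b c, a + b + c = N ∧ Y a b c = 1 ∧ Z a b c = 0)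
    (hZ : ∀ a < x, ∃ b c, a + b + c = N ∧ Y a b c = 0 ∧ Z a b c = 1) :
    2 * (x : ℤ) +
      ∑ s ∈ Finset.range (z + 1), colourDist s (X (x + s) (N - (x + s)) 0)
        (Y (x + s) (N - (x + s)) 0) (Z (x + s) (N - (x + s)) 0) +
      ∑ s ∈ Finset.range (y + 1), colourDist s (X (x + s) 0 (N - (x + s)))
        (Y (x + s) 0 (N - (x + s))) (Z (x + s) 0 (N - (x + s))) ≤
      lineVar N X + lineVar N Y + lineVar N Z := by
  have hlow : ∀ a ∈ Finset.range x, (2 : ℤ) ≤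
      ∑ s ∈ Finset.range (N - a), |X a (s + 1) (N - 1 - a - s) - X a s (N - 1 - a - s + 1)| +
      ∑ s ∈ Finset.range (N - a), |Y a (s + 1) (N - 1 - a - s) - Y a s (N - 1 - a - s + 1)| +
      ∑ s ∈ Finset.range (N - a), |Z a (s + 1) (N - 1 - a - s) - Z a s (N - 1 - a - s + 1)| := by
    intro a ha
    rw [Finset.mem_range] at ha
    obtain ⟨s, c, hs, h1, h2⟩ := hY a ha
    obtain ⟨t, c', ht, h3, h4⟩ := hZ a ha
    obtain rfl : N - a - s = c := by omega
    obtain rfl : N - a - t = c' := by omega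
    replace hs : s ≤ N - a := by omega
    replace ht : t ≤ N - a := by omega
    have hX0 : 0 ≤ ∑ s ∈ Finset.range (N - a),
        |X a (s + 1) (N - 1 - a - s) - X a s (N - 1 - a - s + 1)| :=
      Finset.sum_nonneg fun _ _ => abs_nonneg _
    have e1 := line_abs_le N Y (by omega) hs
    have e2 := line_abs_le N Y (by omega) ht
    have e3 := line_abs_le N Z (by omega) hs
    have e4 := line_abs_le N Z (by omega) ht
    rw [h1] at e1
    rw [h3] at e2
    rw [h2] at e3
    rw [h4] at e4
    have k1 := abs_sub_le (1 : ℤ) (Y a 0 (N - a)) 0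
    have k2 := abs_sub_le (1 : ℤ) (Y a (N - a) 0) 0
    have k3 := abs_sub_le (1 : ℤ) (Z a 0 (N - a)) 0
    have k4 := abs_sub_le (1 : ℤ) (Z a (N - a) 0) 0
    simp only [sub_zero, zero_sub, abs_neg, abs_one] at k1 k2 k3 k4 e2 e3
    omega
  have hhigh : ∀ s ∈ Finset.range (y + z + 1),
      colourDist s (X (x + s) (N - (x + s)) 0) (Y (x + s) (N - (x + s)) 0)
        (Z (x + s) (N - (x + s)) 0) +
      colourDist s (X (x + s) 0 (N - (x + s))) (Y (x + s) 0 (N - (x + s)))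
        (Z (x + s) 0 (N - (x + s))) ≤
      ∑ t ∈ Finset.range (N - (x + s)), |X (x + s) (t + 1) (N - 1 - (x + s) - t) -
        X (x + s) t (N - 1 - (x + s) - t + 1)| +
      ∑ t ∈ Finset.range (N - (x + s)), |Y (x + s) (t + 1) (N - 1 - (x + s) - t) -
        Y (x + s) t (N - 1 - (x + s) - t + 1)| +
      ∑ t ∈ Finset.range (N - (x + s)), |Z (x + s) (t + 1) (N - 1 - (x + s) - t) -
        Z (x + s) t (N - 1 - (x + s) - t + 1)| := by
    intro s hs
    rw [Finset.mem_range] at hs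
    obtain ⟨w, hw, h1, h2, h3⟩ : ∃ w ≤ N - (x + s),
        X (x + s) w (N - (x + s) - w) = (if 0 < s then 1 else 0) ∧
        Y (x + s) w (N - (x + s) - w) = 0 ∧ Z (x + s) w (N - (x + s) - w) = 0 := by
      by_cases h : 0 < s
      · rw [if_pos h]
        obtain ⟨b, c, h1, h2⟩ := hX (x + s) (by omega) (by omega)
        obtain rfl : N - (x + s) - b = c := by omega
        exact ⟨b, by omega, h2⟩
      · obtain rfl : s = 0 := by omega
        refine ⟨y, by omega, ?_⟩
        rw [if_neg h, Nat.add_zero, show N - x - y = z by omega]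
        exact hv
    have e1 := line_abs_le N X (by omega) hw
    have e2 := line_abs_le N Y (by omega) hw
    have e3 := line_abs_le N Z (by omega) hw
    rw [h1] at e1
    rw [h2] at e2
    rw [h3] at e3
    simp only [zero_sub, abs_neg] at e2 e3
    unfold colourDist
    omega
  have h1 := Finset.sum_le_sum hlow
  have h2 := Finset.sum_le_sum hhigh
  rw [Finset.sum_const, Finset.card_range, nsmul_eq_mul] at h1
  rw [Finset.sum_add_distrib] at h2
  have h3 := Finset.sum_le_sum_of_subset_of_nonneg (f := fun s =>
    colourDist s (X (x + s) (N - (x + s)) 0) (Y (x + s) (N - (x + s)) 0)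
      (Z (x + s) (N - (x + s)) 0))
    (Finset.range_subset_range.2 (show z + 1 ≤ y + z + 1 by omega))
    fun _ _ _ => colourDist_nonneg _ _ _ _
  have h4 := Finset.sum_le_sum_of_subset_of_nonneg (f := fun s =>
    colourDist s (X (x + s) 0 (N - (x + s))) (Y (x + s) 0 (N - (x + s)))
      (Z (x + s) 0 (N - (x + s))))
    (Finset.range_subset_range.2 (show y + 1 ≤ y + z + 1 by omega))
    fun _ _ _ => colourDist_nonneg _ _ _ _
  unfold lineVar
  rw [← Finset.sum_add_distrib, ← Finset.sum_add_distrib,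
    show N + 1 = x + (y + z + 1) by omega, Finset.sum_range_add _ x (y + z + 1)]
  linarith

/-- The two lines through a point of a side of the grid contribute together at least `2` if both of
them pass beyond the uncoloured vertex, by the triangle inequality for `colourDist`. -/
theorem two_mul_le_sum_colourDist (m : ℕ) (p q r p' q' r' : ℕ → ℤ)
    (hp : ∀ s ≤ m, p' s = p (m - s)) (hq : ∀ s ≤ m, q' s = q (m - s))
    (hr : ∀ s ≤ m, r' s = r (m - s)) :
    2 * (m : ℤ) ≤ ∑ s ∈ Finset.range (m + 1), colourDist s (p s) (q s) (r s) +
      ∑ s ∈ Finset.range (m + 1), colourDist s (q' s) (r' s) (p' s) := by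
  have hone : ∑ s ∈ Finset.range (m + 1), (if 0 < s then (1 : ℤ) else 0) = m := by
    rw [Finset.sum_range_succ']
    simp
  rw [← Finset.sum_range_reflect (fun s => colourDist s (q' s) (r' s) (p' s)),
    ← Finset.sum_add_distrib]
  have hone' := Finset.sum_range_reflect (fun s => if 0 < s then (1 : ℤ) else 0) (m + 1)
  rw [hone] at hone'
  calc 2 * (m : ℤ) = ∑ s ∈ Finset.range (m + 1), ((if 0 < s then (1 : ℤ) else 0) +
        if 0 < m + 1 - 1 - s then (1 : ℤ) else 0) := by
        rw [Finset.sum_add_distrib, hone, hone']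
        ring
    _ ≤ _ := by
      refine Finset.sum_le_sum fun s hs => ?_
      rw [Finset.mem_range] at hs
      have e : m - (m + 1 - 1 - s) = s := by omega
      rw [hp _ (by omega), hq _ (by omega), hr _ (by omega), e]
      unfold colourDist
      generalize (if 0 < s then (1 : ℤ) else 0) = δ
      generalize (if 0 < m + 1 - 1 - s then (1 : ℤ) else 0) = ε
      have h1 := abs_sub_le δ (p s) 0
      have h2 := abs_sub_le ε (q s) 0
      have h3 := abs_nonneg (r s)
      have h4 := le_abs_self δ
      have h5 := le_abs_self ε
      simp only [sub_zero] at h1 h2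
      omega

theorem exists_mem_support_eq {V : Type*} {G : SimpleGraph V} (φ : V → ℕ)
    (hφ : ∀ p q, G.Adj p q → φ p ≤ φ q + 1) {u w : V} (p : G.Walk u w) {t : ℕ}
    (h : φ u ≤ t ∧ t ≤ φ w ∨ φ w ≤ t ∧ t ≤ φ u) : ∃ x ∈ p.support, φ x = t := by
  induction p with
  | nil => exact ⟨_, SimpleGraph.Walk.start_mem_support _, by omega⟩
  | @cons u u' w hadj p ih =>
    by_cases hu : φ u = t
    · exact ⟨u, SimpleGraph.Walk.start_mem_support _, hu⟩
    · have h1 := hφ _ _ hadj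
      have h2 := hφ _ _ hadj.symm
      obtain ⟨x, hx, e⟩ := ih (by omega)
      exact ⟨x, by simp [hx], e⟩

/-- The third barycentric coordinate. -/
def zCoord {N : ℕ} (p : TriVertex (N + 1)) : ℕ := N - p.1.1 - p.1.2

theorem coord_le_of_adj {N : ℕ} {p q : TriVertex (N + 1)} (h : (triangularGrid (N + 1)).Adj p q) :
    (p.1.1 : ℕ) ≤ q.1.1 + 1 ∧ (p.1.2 : ℕ) ≤ q.1.2 + 1 ∧ zCoord p ≤ zCoord q + 1 := by
  have hp := p.2
  have hq := q.2
  simp only [triangularGrid, TriStep] at h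
  unfold zCoord
  omega

theorem indicatorFn_eq_one {N : ℕ} {A : Set (TriVertex (N + 1))} {p : TriVertex (N + 1)}
    (h : p ∈ A) : indicatorFn A p.1.1 p.1.2 (zCoord p) = 1 := by
  have := p.2
  exact if_pos ⟨p, h, rfl, rfl, by unfold zCoord; omega⟩

theorem indicatorFn_eq_zero {N : ℕ} {A : Set (TriVertex (N + 1))} {p : TriVertex (N + 1)}
    (h : p ∉ A) : indicatorFn A p.1.1 p.1.2 (zCoord p) = 0 := by
  refine if_neg ?_
  rintro ⟨q, hq, h1, h2, -⟩
  refine h ?_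
  have : q = p := by
    simp [Subtype.ext_iff, Prod.ext_iff, Fin.ext_iff, h1, h2]
  rwa [← this]

/-- The variation of a colouring with three classes along all lines of the grid, where `(x, y, z)` is
an uncoloured vertex and each class meets the lines which separate this vertex from the corner of
the class. -/
theorem four_mul_le_lineVar_add (N : ℕ) (X Y Z : ℕ → ℕ → ℕ → ℤ) {x y z : ℕ} (hN : x + y + z = N)
    (hv : X x y z = 0 ∧ Y x y z = 0 ∧ Z x y z = 0)
    (hX : ∀ a b c, a + b + c = N → X a b c = 1 → Y a b c = 0 ∧ Z a b c = 0)
    (hY : ∀ a b c, a + b + c = N → Y a b c = 1 → X a b c = 0 ∧ Z a b c = 0)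
    (hZ : ∀ a b c, a + b + c = N → Z a b c = 1 → X a b c = 0 ∧ Y a b c = 0)
    (hXx : ∀ a, x < a → a ≤ N → ∃ b c, a + b + c = N ∧ X a b c = 1)
    (hYx : ∀ a < x, ∃ b c, a + b + c = N ∧ Y a b c = 1)
    (hZx : ∀ a < x, ∃ b c, a + b + c = N ∧ Z a b c = 1)
    (hYy : ∀ b, y < b → b ≤ N → ∃ a c, a + b + c = N ∧ Y a b c = 1)
    (hXy : ∀ b < y, ∃ a c, a + b + c = N ∧ X a b c = 1)
    (hZy : ∀ b < y, ∃ a c, a + b + c = N ∧ Z a b c = 1)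
    (hZz : ∀ c, z < c → c ≤ N → ∃ a b, a + b + c = N ∧ Z a b c = 1)
    (hXz : ∀ c < z, ∃ a b, a + b + c = N ∧ X a b c = 1)
    (hYz : ∀ c < z, ∃ a b, a + b + c = N ∧ Y a b c = 1) :
    4 * (N : ℤ) ≤
      (lineVar N X + lineVar N (rotate X) + lineVar N (rotate (rotate X))) +
      (lineVar N Y + lineVar N (rotate Y) + lineVar N (rotate (rotate Y))) +
      (lineVar N Z + lineVar N (rotate Z) + lineVar N (rotate (rotate Z))) := by
  have bx := le_lineVar_add N X Y Z hN hv
    (fun a h1 h2 => by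
      obtain ⟨b, c, h, e⟩ := hXx a h1 h2
      exact ⟨b, c, h, e, hX a b c h e⟩)
    (fun a h1 => by
      obtain ⟨b, c, h, e⟩ := hYx a h1
      exact ⟨b, c, h, e, (hY a b c h e).2⟩)
    (fun a h1 => by
      obtain ⟨b, c, h, e⟩ := hZx a h1
      exact ⟨b, c, h, (hZ a b c h e).2, e⟩)
  have bY := le_lineVar_add N (rotate Y) (rotate Z) (rotate X) (x := y) (y := z) (z := x)
    (by omega) ⟨hv.2.1, hv.2.2, hv.1⟩
    (fun b h1 h2 => by
      obtain ⟨a, c, h, e⟩ := hYy b h1 h2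
      exact ⟨c, a, by omega, e, (hY a b c h e).symm⟩)
    (fun b h1 => by
      obtain ⟨a, c, h, e⟩ := hZy b h1
      exact ⟨c, a, by omega, e, (hZ a b c h e).1⟩)
    (fun b h1 => by
      obtain ⟨a, c, h, e⟩ := hXy b h1
      exact ⟨c, a, by omega, (hX a b c h e).2, e⟩)
  have bz := le_lineVar_add N (rotate (rotate Z)) (rotate (rotate X)) (rotate (rotate Y))
    (x := z) (y := x) (z := y) (by omega) ⟨hv.2.2, hv.1, hv.2.1⟩
    (fun c h1 h2 => by
      obtain ⟨a, b, h, e⟩ := hZz c h1 h2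
      exact ⟨a, b, by omega, e, hZ a b c h e⟩)
    (fun c h1 => by
      obtain ⟨a, b, h, e⟩ := hXz c h1
      exact ⟨a, b, by omega, e, (hX a b c h e).1⟩)
    (fun c h1 => by
      obtain ⟨a, b, h, e⟩ := hYz c h1
      exact ⟨a, b, by omega, (hY a b c h e).1, e⟩)
  -- the side on which the third coordinate vanishes, then those for the first and the second
  have sz := two_mul_le_sum_colourDist z (fun s => X (x + s) (N - (x + s)) 0)
    (fun s => Y (x + s) (N - (x + s)) 0) (fun s => Z (x + s) (N - (x + s)) 0)
    (fun s => X (N - (y + s)) (y + s) 0) (fun s => Y (N - (y + s)) (y + s) 0)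
    (fun s => Z (N - (y + s)) (y + s) 0)
    (fun s hs => by congr 1 <;> omega) (fun s hs => by congr 1 <;> omega)
    (fun s hs => by congr 1 <;> omega)
  have sx := two_mul_le_sum_colourDist x (fun s => Y 0 (y + s) (N - (y + s)))
    (fun s => Z 0 (y + s) (N - (y + s))) (fun s => X 0 (y + s) (N - (y + s)))
    (fun s => Y 0 (N - (z + s)) (z + s)) (fun s => Z 0 (N - (z + s)) (z + s))
    (fun s => X 0 (N - (z + s)) (z + s))
    (fun s hs => by congr 1 <;> omega) (fun s hs => by congr 1 <;> omega)
    (fun s hs => by congr 1 <;> omega)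
  have sy := two_mul_le_sum_colourDist y (fun s => Z (N - (z + s)) 0 (z + s))
    (fun s => X (N - (z + s)) 0 (z + s)) (fun s => Y (N - (z + s)) 0 (z + s))
    (fun s => Z (x + s) 0 (N - (x + s))) (fun s => X (x + s) 0 (N - (x + s)))
    (fun s => Y (x + s) 0 (N - (x + s)))
    (fun s hs => by congr 1 <;> omega) (fun s hs => by congr 1 <;> omega)
    (fun s hs => by congr 1 <;> omega)
  have hN' : (x : ℤ) + y + z = N := by exact_mod_cast hN
  simp only [rotate] at bY bz sx sy sz ⊢
  linarith

/-- If three disjoint sets avoiding a vertex `v` contain, together with `v`, walks from `v` to the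
three corners of the grid, then their edge boundaries have at least `4 N` edges in total. -/
theorem four_mul_le_sum_ncard {N : ℕ} {v : TriVertex (N + 1)}
    {S : Fin 3 → Set (TriVertex (N + 1))} (hv : ∀ i, v ∉ S i)
    (hS : ∀ i j, i ≠ j → Disjoint (S i) (S j))
    (hwalk : ∀ i, ∃ p : (triangularGrid (N + 1)).Walk v
      (![gridVertex N N 0 le_rfl, gridVertex N 0 N (by omega), gridVertex N 0 0 (by omega)] i),
        ∀ w ∈ p.support, w = v ∨ w ∈ S i) :
    4 * N ≤ (edgesBetween (triangularGrid (N + 1)) (S 0) (S 0)ᶜ).ncard +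
      (edgesBetween (triangularGrid (N + 1)) (S 1) (S 1)ᶜ).ncard +
      (edgesBetween (triangularGrid (N + 1)) (S 2) (S 2)ᶜ).ncard := by
  have hdisj : ∀ {i j} {w : TriVertex (N + 1)}, w ∈ S i → i ≠ j → w ∉ S j :=
    fun h hij => Set.disjoint_left.1 (hS _ _ hij) h
  have hc := v.2
  -- each class meets every line that separates `v` from its corner
  have hmeet : ∀ (i : Fin 3) (φ : TriVertex (N + 1) → ℕ),
      (∀ p q, (triangularGrid (N + 1)).Adj p q → φ p ≤ φ q + 1) → ∀ t, t ≠ φ v →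
      (φ v ≤ t ∧ t ≤ φ (![gridVertex N N 0 le_rfl, gridVertex N 0 N (by omega),
          gridVertex N 0 0 (by omega)] i) ∨
        φ (![gridVertex N N 0 le_rfl, gridVertex N 0 N (by omega),
          gridVertex N 0 0 (by omega)] i) ≤ t ∧ t ≤ φ v) → ∃ w ∈ S i, φ w = t := by
    intro i φ hφ t ht h
    obtain ⟨p, hp⟩ := hwalk i
    obtain ⟨w, hw, e⟩ := exists_mem_support_eq φ hφ p h
    rcases hp w hw with rfl | h'
    · exact absurd e.symm ht
    · exact ⟨w, h', e⟩
  have hx : ∀ p q : TriVertex (N + 1), (triangularGrid (N + 1)).Adj p q →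
      (p.1.1 : ℕ) ≤ q.1.1 + 1 := fun p q h => (coord_le_of_adj h).1
  have hy : ∀ p q : TriVertex (N + 1), (triangularGrid (N + 1)).Adj p q →
      (p.1.2 : ℕ) ≤ q.1.2 + 1 := fun p q h => (coord_le_of_adj h).2.1
  have hz : ∀ p q : TriVertex (N + 1), (triangularGrid (N + 1)).Adj p q →
      zCoord p ≤ zCoord q + 1 := fun p q h => (coord_le_of_adj h).2.2
  have hsum : ∀ w : TriVertex (N + 1), (w.1.1 : ℕ) + w.1.2 + zCoord w = N := fun w => by
    have := w.2
    unfold zCoord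
    omega
  have hval : ∀ i j k, i ≠ j → i ≠ k → ∀ a b c, a + b + c = N →
      indicatorFn (S i) a b c = 1 → indicatorFn (S j) a b c = 0 ∧ indicatorFn (S k) a b c = 0 := by
    intro i j k hij hik a b c habc h
    have hmem : gridVertex N a b (by omega) ∈ S i := by
      by_contra hcon
      rw [indicatorFn_gridVertex _ habc, if_neg hcon] at h
      exact zero_ne_one h
    rw [indicatorFn_gridVertex _ habc, indicatorFn_gridVertex _ habc,
      if_neg (hdisj hmem hij), if_neg (hdisj hmem hik)]
    exact ⟨rfl, rfl⟩
  have hvsum := hsum v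
  have key := four_mul_le_lineVar_add N (indicatorFn (S 0)) (indicatorFn (S 1)) (indicatorFn (S 2))
    hvsum ⟨indicatorFn_eq_zero (hv 0), indicatorFn_eq_zero (hv 1), indicatorFn_eq_zero (hv 2)⟩
    (hval 0 1 2 (by decide) (by decide)) (hval 1 0 2 (by decide) (by decide))
    (hval 2 0 1 (by decide) (by decide))
    (fun a h1 h2 => by
      obtain ⟨w, hw, rfl⟩ := hmeet 0 (fun p => p.1.1) hx a (by omega)
        (by simp [gridVertex]; omega)
      exact ⟨_, _, hsum w, indicatorFn_eq_one hw⟩)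
    (fun a h1 => by
      obtain ⟨w, hw, rfl⟩ := hmeet 1 (fun p => p.1.1) hx a (by omega)
        (by simp [gridVertex]; omega)
      exact ⟨_, _, hsum w, indicatorFn_eq_one hw⟩)
    (fun a h1 => by
      obtain ⟨w, hw, rfl⟩ := hmeet 2 (fun p => p.1.1) hx a (by omega)
        (by simp [gridVertex]; omega)
      exact ⟨_, _, hsum w, indicatorFn_eq_one hw⟩)
    (fun a h1 h2 => by
      obtain ⟨w, hw, rfl⟩ := hmeet 1 (fun p => p.1.2) hy a (by omega)
        (by simp [gridVertex]; omega)
      exact ⟨_, _, hsum w, indicatorFn_eq_one hw⟩)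
    (fun a h1 => by
      obtain ⟨w, hw, rfl⟩ := hmeet 0 (fun p => p.1.2) hy a (by omega)
        (by simp [gridVertex]; omega)
      exact ⟨_, _, hsum w, indicatorFn_eq_one hw⟩)
    (fun a h1 => by
      obtain ⟨w, hw, rfl⟩ := hmeet 2 (fun p => p.1.2) hy a (by omega)
        (by simp [gridVertex]; omega)
      exact ⟨_, _, hsum w, indicatorFn_eq_one hw⟩)
    (fun a h1 h2 => by
      obtain ⟨w, hw, rfl⟩ := hmeet 2 zCoord hz a (by omega)
        (by simp [gridVertex, zCoord]; omega)
      exact ⟨_, _, hsum w, indicatorFn_eq_one hw⟩)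
    (fun a h1 => by
      obtain ⟨w, hw, rfl⟩ := hmeet 0 zCoord hz a (by omega)
        (by simp [gridVertex, zCoord]; omega)
      exact ⟨_, _, hsum w, indicatorFn_eq_one hw⟩)
    (fun a h1 => by
      obtain ⟨w, hw, rfl⟩ := hmeet 1 zCoord hz a (by omega)
        (by simp [gridVertex, zCoord]; omega)
      exact ⟨_, _, hsum w, indicatorFn_eq_one hw⟩)
  rw [← ncard_edgesBetween_compl_eq_lineVar, ← ncard_edgesBetween_compl_eq_lineVar,
    ← ncard_edgesBetween_compl_eq_lineVar] at key
  exact_mod_cast key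

theorem exists_two_mul_le_edgeCongestion {N : ℕ} {T : SimpleGraph (TriVertex (N + 1))}
    (hT : IsSpanningTree (triangularGrid (N + 1)) T) :
    ∃ t, 2 * N ≤ 3 * t ∧ 2 * t ≤ edgeCongestion (triangularGrid (N + 1)) T := by
  obtain ⟨v, S, hv, hS, hwalk, hle⟩ := exists_median hT
    ![gridVertex N N 0 le_rfl, gridVertex N 0 N (by omega), gridVertex N 0 0 (by omega)]
  have h := four_mul_le_sum_ncard hv hS hwalk
  have h0 := hle 0
  have h1 := hle 1
  have h2 := hle 2
  rw [ncard_edgesBetween_compl_eq_two_mul] at h0 h1 h2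
  simp only [ncard_edgesBetween_compl_eq_two_mul] at h
  refine ⟨max (cutTriangles (S 0)).ncard
    (max (cutTriangles (S 1)).ncard (cutTriangles (S 2)).ncard), ?_, ?_⟩ <;> omega

/-! ### Trees that attain the bound -/

/-- The vertices whose first two barycentric coordinates satisfy `P`. -/
def gridSet (N : ℕ) (P : ℕ → ℕ → Prop) : Set (TriVertex (N + 1)) := {p | P p.1.1 p.1.2}

/-- Triangles cut by a set are counted by an injective labelling with the numbers below `m`. -/
theorem ncard_cutTriangles_le {N : ℕ} (P : ℕ → ℕ → Prop) (φ : ℕ → ℕ → ℕ) (m : ℕ)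
    (hlt : ∀ i j, i + j < N → ¬((P i j ↔ P (i + 1) j) ∧ (P i j ↔ P i (j + 1))) → φ i j < m)
    (hinj : ∀ i j i' j', i + j < N → i' + j' < N →
      ¬((P i j ↔ P (i + 1) j) ∧ (P i j ↔ P i (j + 1))) →
      ¬((P i' j' ↔ P (i' + 1) j') ∧ (P i' j' ↔ P i' (j' + 1))) →
      φ i j = φ i' j' → i = i' ∧ j = j') :
    (cutTriangles (gridSet N P)).ncard ≤ m := by
  have h := Set.ncard_le_ncard_of_injOn (s := cutTriangles (gridSet N P)) (t := Set.Iio m)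
    (fun t => φ t.1.1 t.1.2) (fun t ht => hlt _ _ t.2 ht) (fun t ht t' ht' e => by
      have := hinj _ _ _ _ t.2 t'.2 ht ht' e
      simpa [Subtype.ext_iff, Prod.ext_iff, Fin.ext_iff] using this) (Set.finite_Iio m)
  rwa [Set.ncard_eq_toFinset_card' (Set.Iio m), Set.toFinset_Iio, Nat.card_Iio] at h

theorem ncard_cutTriangles_first_ge_le {N a : ℕ} :
    (cutTriangles (gridSet N fun x _ => a ≤ x)).ncard ≤ N - a + 1 := by
  refine ncard_cutTriangles_le _ (fun _ j => j) _ ?_ ?_ <;> intros <;> omega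

theorem ncard_cutTriangles_third_ge_le {N c : ℕ} :
    (cutTriangles (gridSet N fun x y => c ≤ N - x - y)).ncard ≤ N - c + 1 := by
  refine ncard_cutTriangles_le _ (fun i _ => i) _ ?_ ?_ <;> intros <;> omega

theorem ncard_cutTriangles_first_ge_third_le_le {N a r : ℕ} :
    (cutTriangles (gridSet N fun x y => a ≤ x ∧ N - x - y ≤ r)).ncard ≤ N - a + 1 := by
  refine ncard_cutTriangles_le _ (fun _ j => j) _ ?_ ?_ <;> intros <;> omega

theorem ncard_cutTriangles_first_le_third_le_le {N a r : ℕ} :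
    (cutTriangles (gridSet N fun x y => x ≤ a ∧ N - x - y ≤ r)).ncard ≤ a + r + 1 := by
  refine ncard_cutTriangles_le _
    (fun i j => if i = a then a + r - (N - 1 - i - j) else i) _ ?_ ?_ <;>
    intros <;> split_ifs at * <;> omega

theorem ncard_cutTriangles_first_eq_third_le_le {N a c : ℕ} :
    (cutTriangles (gridSet N fun x y => x = a ∧ N - x - y ≤ c)).ncard ≤ 2 * (c + 1) := by
  refine ncard_cutTriangles_le _
    (fun i j => 2 * (N - 1 - i - j) + if i = a then 1 else 0) _ ?_ ?_ <;>
    intros <;> split_ifs at * <;> omega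

theorem ncard_cutTriangles_third_eq_first_le_le {N a c : ℕ} :
    (cutTriangles (gridSet N fun x y => N - x - y = c ∧ x ≤ a)).ncard ≤ 2 * (a + 1) := by
  refine ncard_cutTriangles_le _
    (fun i j => 2 * i + if N - 1 - i - j = c then 1 else 0) _ ?_ ?_ <;>
    intros <;> split_ifs at * <;> omega

theorem ncard_cutTriangles_third_eq_first_ge_le {N a c : ℕ} :
    (cutTriangles (gridSet N fun x y => N - x - y = c ∧ a ≤ x)).ncard ≤ 2 * (N - c - a + 1) := by
  refine ncard_cutTriangles_le _
    (fun i j => 2 * j + if N - 1 - i - j = c then 1 else 0) _ ?_ ?_ <;>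
    intros <;> split_ifs at * <;> omega

/-- The first two barycentric coordinates of the parent of `(x, y)`, in the tree which is rooted at
the middle of the row on which the third coordinate is `r`. Above this row, the tree consists of
the halves of the rows and of a spine that joins their middle vertices; the row itself belongs to
the tree; the lines below it on which the first coordinate is constant are attached to the row or,
near the first corner, to the side of the grid on which the second coordinate is `0`. -/
def parentCoord (N r x y : ℕ) : ℕ × ℕ :=
  if N - x - y < r then if 1 ≤ y then (x, y - 1) else (x - 1, y)
  else if x < (N - (N - x - y)) / 2 then (x + 1, y - 1)
  else if (N - (N - x - y)) / 2 < x then (x - 1, y + 1)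
  else ((N - (N - x - y - 1)) / 2, N - (N - x - y - 1) - (N - (N - x - y - 1)) / 2)

/-- The descendants of `(x, y)` in the tree given by `parentCoord`, if `(x, y)` is not the root. -/
def IsDescendant (N r x y x' y' : ℕ) : Prop :=
  if N - x - y < r then if 1 ≤ y then x' = x ∧ N - x' - y' ≤ N - x - y else x ≤ x'
  else if N - x - y = r then
    if x < (N - (N - x - y)) / 2 then x' ≤ x ∧ N - x' - y' ≤ r else x ≤ x' ∧ N - x' - y' ≤ r
  else if x < (N - (N - x - y)) / 2 then N - x' - y' = N - x - y ∧ x' ≤ x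
  else if (N - (N - x - y)) / 2 < x then N - x' - y' = N - x - y ∧ x ≤ x'
  else N - x - y ≤ N - x' - y'

/-- A function that decreases from each vertex to its parent. -/
def parentRank (N r x y : ℕ) : ℕ :=
  if N - x - y < r then N + 1 + (r - (N - x - y))
  else N - x - y - r + (x - (N - (N - x - y)) / 2) + ((N - (N - x - y)) / 2 - x)

theorem parentCoord_add_le {N r x y : ℕ} (h : x + y ≤ N) :
    (parentCoord N r x y).1 + (parentCoord N r x y).2 ≤ N := by
  unfold parentCoord
  split_ifs <;> simp only <;> omega

theorem parentRank_parentCoord_lt {N r x y : ℕ} (hr : r ≤ N) (h : x + y ≤ N)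
    (hne : ¬(N - x - y = r ∧ x = (N - r) / 2)) :
    parentRank N r (parentCoord N r x y).1 (parentCoord N r x y).2 < parentRank N r x y := by
  unfold parentCoord parentRank
  split_ifs <;> simp only at * <;> omega

theorem isDescendant_self {N r x y : ℕ} : IsDescendant N r x y x y := by
  unfold IsDescendant
  split_ifs <;> omega

theorem not_isDescendant_parentCoord {N r x y : ℕ} (hr : r ≤ N) (h : x + y ≤ N)
    (hne : ¬(N - x - y = r ∧ x = (N - r) / 2)) :
    ¬IsDescendant N r x y (parentCoord N r x y).1 (parentCoord N r x y).2 := by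
  unfold parentCoord IsDescendant
  split_ifs <;> simp only at * <;> omega

theorem isDescendant_iff_parentCoord {N r x y x' y' : ℕ} (hr : r ≤ N) (h : x + y ≤ N)
    (h' : x' + y' ≤ N) (hroot : ¬(N - x - y = r ∧ x = (N - r) / 2))
    (hroot' : ¬(N - x' - y' = r ∧ x' = (N - r) / 2)) (hne : ¬(x' = x ∧ y' = y)) :
    IsDescendant N r x y x' y' ↔
      IsDescendant N r x y (parentCoord N r x' y').1 (parentCoord N r x' y').2 := by
  unfold parentCoord IsDescendant
  split_ifs <;> simp only at * <;> omega

theorem adj_parentCoord {N r x y : ℕ} (hr : r ≤ N) (h : x + y ≤ N)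
    (hne : ¬(N - x - y = r ∧ x = (N - r) / 2)) :
    (triangularGrid (N + 1)).Adj (gridVertex N x y h)
      (gridVertex N (parentCoord N r x y).1 (parentCoord N r x y).2 (parentCoord_add_le h)) := by
  simp only [triangularGrid, TriStep, gridVertex]
  unfold parentCoord
  split_ifs <;> simp only [true_and, and_true] at * <;> omega

theorem ncard_cutTriangles_isDescendant_le {N r M x y : ℕ} (hr : r ≤ N) (h1 : 2 * r ≤ M)
    (h2 : (N - r) / 2 + r ≤ M) (h3 : N - (N - r) / 2 ≤ M) (h4 : N - r ≤ M) (h : x + y ≤ N)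
    (hne : ¬(N - x - y = r ∧ x = (N - r) / 2)) :
    (cutTriangles (gridSet N (IsDescendant N r x y))).ncard ≤ M := by
  unfold IsDescendant
  split_ifs with c1 c2 c3 c4 c5 c6
  · exact ncard_cutTriangles_first_eq_third_le_le.trans (by omega)
  · exact ncard_cutTriangles_first_ge_le.trans (by omega)
  · exact ncard_cutTriangles_first_le_third_le_le.trans (by omega)
  · exact ncard_cutTriangles_first_ge_third_le_le.trans (by omega)
  · exact ncard_cutTriangles_third_eq_first_le_le.trans (by omega)
  · exact ncard_cutTriangles_third_eq_first_ge_le.trans (by omega)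
  · exact ncard_cutTriangles_third_ge_le.trans (by omega)

theorem exists_isSpanningTree_edgeCongestion_le {N r M : ℕ} (hr : r ≤ N) (h1 : 2 * r ≤ M)
    (h2 : (N - r) / 2 + r ≤ M) (h3 : N - (N - r) / 2 ≤ M) (h4 : N - r ≤ M) :
    ∃ T, IsSpanningTree (triangularGrid (N + 1)) T ∧
      edgeCongestion (triangularGrid (N + 1)) T ≤ 2 * M := by
  have hle : ∀ p : TriVertex (N + 1), (p.1.1 : ℕ) + p.1.2 ≤ N := fun p => by
    have := p.2
    omega
  have hroot : ∀ p : TriVertex (N + 1),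
      p ≠ gridVertex N ((N - r) / 2) (N - r - (N - r) / 2) (by omega) →
      ¬(N - p.1.1 - p.1.2 = r ∧ (p.1.1 : ℕ) = (N - r) / 2) := by
    intro p hp hcon
    obtain ⟨i, j, hij, rfl⟩ := exists_gridVertex p
    rw [Ne, gridVertex_inj] at hp
    simp only [gridVertex] at hcon
    omega
  refine exists_spanningTree_of_parent
    (gridVertex N ((N - r) / 2) (N - r - (N - r) / 2) (by omega))
    (fun p => gridVertex N (parentCoord N r p.1.1 p.1.2).1 (parentCoord N r p.1.1 p.1.2).2
      (parentCoord_add_le (hle p)))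
    (fun p => parentRank N r p.1.1 p.1.2) (fun p hp => adj_parentCoord hr (hle p) (hroot p hp))
    (fun p hp => parentRank_parentCoord_lt hr (hle p) (hroot p hp))
    (fun p => gridSet N (IsDescendant N r p.1.1 p.1.2)) (fun p _ => isDescendant_self)
    (fun p hp => not_isDescendant_parentCoord hr (hle p) (hroot p hp))
    (fun p hp q hq hne => isDescendant_iff_parentCoord hr (hle p) (hle q) (hroot p hp)
      (hroot q hq) fun h => hne ?_) _ fun p hp => ?_
  · simpa [Subtype.ext_iff, Prod.ext_iff, Fin.ext_iff] using h
  · rw [ncard_edgesBetween_compl_eq_two_mul]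
    exact Nat.mul_le_mul_left 2
      (ncard_cutTriangles_isDescendant_le hr h1 h2 h3 h4 (hle p) (hroot p hp))

/-- The bounds combined: `M` is the least integer that is at least `2 N / 3`, and `r` is the row from
which the optimal tree is built. -/
theorem isSpanningTreeCongestion_triangularGrid {N r M : ℕ} (hr : r ≤ N) (h1 : 2 * r ≤ M)
    (h2 : (N - r) / 2 + r ≤ M) (h3 : N - (N - r) / 2 ≤ M) (h4 : N - r ≤ M)
    (hM : 3 * M < 2 * N + 3) :
    IsSpanningTreeCongestion (triangularGrid (N + 1)) (2 * M) := by
  have hlow : ∀ T, IsSpanningTree (triangularGrid (N + 1)) T →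
      2 * M ≤ edgeCongestion (triangularGrid (N + 1)) T := by
    intro T hT
    obtain ⟨t, ht, hle⟩ := exists_two_mul_le_edgeCongestion hT
    omega
  constructor
  · obtain ⟨T, hT, hle⟩ := exists_isSpanningTree_edgeCongestion_le hr h1 h2 h3 h4
    exact ⟨T, hT, le_antisymm hle (hlow T hT)⟩
  · rintro d ⟨T, hT, rfl⟩
    exact hlow T hT

theorem theorem3 (n : ℕ) :
    (1 ≤ n → IsSpanningTreeCongestion (triangularGrid (3 * n)) (4 * n)) ∧
    IsSpanningTreeCongestion (triangularGrid (3 * n + 1)) (4 * n) ∧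
    IsSpanningTreeCongestion (triangularGrid (3 * n + 2)) (4 * n + 2) := by
  refine ⟨fun hn => ?_, ?_, ?_⟩
  · obtain ⟨m, rfl⟩ : ∃ m, n = m + 1 := ⟨n - 1, by omega⟩
    rw [show 4 * (m + 1) = 2 * (2 * (m + 1)) by ring]
    exact isSpanningTreeCongestion_triangularGrid (N := 3 * m + 2) (r := m) (by omega) (by omega)
      (by omega) (by omega) (by omega) (by omega)
  · rw [show 4 * n = 2 * (2 * n) by ring]
    exact isSpanningTreeCongestion_triangularGrid (N := 3 * n) (r := n) (by omega) (by omega)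
      (by omega) (by omega) (by omega) (by omega)
  · rw [show 4 * n + 2 = 2 * (2 * n + 1) by ring]
    exact isSpanningTreeCongestion_triangularGrid (N := 3 * n + 1) (r := n) (by omega) (by omega)
      (by omega) (by omega) (by omega) (by omega)
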